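/- Let $X_1, X_2, \ldots$ be i.i.d. random elements of a measurable space $\mathcal X$, let $\Theta$ be a measurable space and let $f : \Theta \times \mathcal X \to [0,1]$ be measurable. Write $$\mu_\theta := \mathbb E[f(\theta, X_1)], \qquad \hat\mu_\theta := \frac1n \sum_{i=1}^n f(\theta, X_i), \qquad \hat V(P_n) := \frac1n \int \sum_{i=1}^n \big(f(\theta, X_i) - \hat\mu_\theta\big)^2 \, dP_n(\theta).$$ Let $\delta \in (0,1]$ and let $P_0$ be a probability measure on $\Theta$ (a prior, which does not depend on the sample), and set $$\mathcal C_{n,\delta} := \mathrm{KL}(P_n \| P_0) + \ln \frac{\sqrt\pi\, \Gamma(n+1)}{\Gamma(n + \frac12)} + \ln \frac1\delta,$$ where $\mathrm{KL}(P_n\|P_0) = \int \ln \frac{dP_n}{dP_0} \, dP_n$ if $P_n \ll P_0$, and $+\infty$ otherwise. Then with probability at least $1-\delta$ over the sequence $(X_i)_{i \ge 1}$, simultaneously for all integers $n \geq 1$ and all data-dependent distributions $P_n = P(X_1, \ldots, X_n)$ on $\Theta$, where $P$ is a probability kernel from $\mathcal X^n$ to $\Theta$, we have $$\left| \int \mu_\theta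 \, dP_n(\theta) - \int \hat\mu_\theta \, dP_n(\theta) \right| \leq \frac{\sqrt{2\, \mathcal C_{n,\delta}\, \hat V(P_n)}}{\big(\sqrt n - \frac{2}{\sqrt n}\, \mathcal C_{n,\delta}\big)_+} + \frac{2\, \mathcal C_{n,\delta}}{\big(n - 2\, \mathcal C_{n,\delta}\big)_+}.$$ Here $(x)_+ = \max\{x, 0\}$, and the right-hand side is read as $+\infty$ when $2\,\mathcal C_{n,\delta} \ge n$. -/

import Mathlib

open MeasureTheory ProbabilityTheory
open scoped ENNReal

namespace PACBayes

noncomputable section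

variable {Ω 𝒳 Θ : Type*} [MeasurableSpace Ω] [MeasurableSpace 𝒳] [MeasurableSpace Θ]

/-- The mean `μ_θ = 𝔼[f(θ, Y)]`, where `Y` is a random element on `(Ω, Pr)`. -/
def mean (Pr : Measure Ω) (Y : Ω → 𝒳) (f : Θ → 𝒳 → ℝ) (θ : Θ) : ℝ :=
  ∫ ω, f θ (Y ω) ∂Pr

/-- The empirical mean `μ̂_θ = (1/n) ∑ᵢ f(θ, xᵢ)` on the sample `x = (x₁, …, xₙ)`. -/
def empMean (f : Θ → 𝒳 → ℝ) {n : ℕ} (x : Fin n → 𝒳) (θ : Θ) : ℝ :=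
  (1 / (n : ℝ)) * ∑ i, f θ (x i)

/-- The posterior-averaged sample variance
`V̂(Q) = (1/n) ∫ ∑ᵢ (f(θ, xᵢ) - μ̂_θ)² dQ(θ)`. -/
def sampleVar (f : Θ → 𝒳 → ℝ) {n : ℕ} (x : Fin n → 𝒳) (Q : Measure Θ) : ℝ :=
  (1 / (n : ℝ)) * ∫ θ, ∑ i, (f θ (x i) - empMean f x θ) ^ 2 ∂Q

/-- The complexity `C_{n,δ} = KL(Q ‖ P₀) + ln (√π Γ(n+1) / Γ(n+1/2)) + ln (1/δ)`, with values in
`[0, ∞]`; it is `∞` exactly when `KL(Q ‖ P₀) = ∞`. Both logarithms are nonnegative for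
`0 < δ ≤ 1`, so that `ENNReal.ofReal` does not truncate them. -/
def complexity (n : ℕ) (δ : ℝ) (Q P₀ : Measure Θ) : ℝ≥0∞ :=
  InformationTheory.klDiv Q P₀
    + ENNReal.ofReal
        (Real.log (Real.sqrt Real.pi * Real.Gamma ((n : ℝ) + 1) / Real.Gamma ((n : ℝ) + 1 / 2)))
    + ENNReal.ofReal (Real.log (1 / δ))

/-- The empirical Bernstein width
`√(2 C V) / (√n - (2/√n) C)₊ + 2 C / (n - 2 C)₊`, computed in `[0, ∞]`: there subtraction is
`a - b = (a - b)₊` and a positive number divided by `0` is `∞`. -/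
def bernsteinWidth (n : ℕ) (C V : ℝ≥0∞) : ℝ≥0∞ :=
  (2 * C * V) ^ (1 / 2 : ℝ) /
      ((n : ℝ≥0∞) ^ (1 / 2 : ℝ) - 2 / (n : ℝ≥0∞) ^ (1 / 2 : ℝ) * C)
    + 2 * C / ((n : ℝ≥0∞) - 2 * C)

end

end PACBayes

namespace PACBayes

/-! The proof is a betting argument. For fixed θ with mean m, the price relatives f/m and (1 - f)/(1
- m) have expectation at most one, so the wealth of any constant rebalanced portfolio b on these two
assets is a nonnegative supermartingale. So is its mixture over θ ~ P₀ and b ~ Beta(1/2, 1/2).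
Ville's inequality keeps that mixture below 1/δ for all n at once, off an event of probability at
most δ that involves no posterior.

On the good event everything is deterministic. The Beta mixture loses at most the factor
`regretFactor n` against the best b in hindsight (`portfolioWealth_le_lintegral`), and a b tuned to
the empirical mean earns at least the exponential of an empirical Bernstein exponent
(`exp_bernsteinExponent_le_portfolioWealth`). Donsker–Varadhan passes from P₀ to the posterior at
the price of the KL term (`bet_le_complexity`). Optimizing over the betting fraction g yields
√(2CV/n) + 2C/n, which is stronger than the stated width. -/

/-! ### Quadratic lower bound for the logarithm -/

/-- For y ≤ 0 the quadratic coefficient 1/(2(1 + y)) works, and 1 + y ≥ 1 - g; for y ≥ 0 the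
coefficient 1/2 already suffices. -/
lemma sub_sq_div_le_log_one_add {g y : ℝ} (hg0 : 0 ≤ g) (hg : g < 1) (hy : -g ≤ y) :
    y - y ^ 2 / (2 * (1 - g)) ≤ Real.log (1 + y) := by
  rcases le_total 0 y with h | h
  · have h1 := Real.le_log_one_add_of_nonneg h
    refine le_trans ?_ h1
    have h2 : y ^ 2 / 2 ≤ y ^ 2 / (2 * (1 - g)) :=
      div_le_div_of_nonneg_left (sq_nonneg y) (by linarith) (by linarith)
    have h3 : y - y ^ 2 / 2 ≤ 2 * y / (y + 2) := by
      rw [le_div_iff₀ (by linarith)]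
      nlinarith [pow_nonneg h 3]
    linarith
  · have hy1 : 0 < 1 + y := by linarith
    -- `log u ≤ (u - 1/u)/2` for `u ≥ 1`
    have key : ∀ u : ℝ, 1 ≤ u → Real.log u ≤ (u - 1 / u) / 2 := by
      intro u hu
      have hmono : MonotoneOn (fun u : ℝ => (u - 1 / u) / 2 - Real.log u) (Set.Ici 1) := by
        apply monotoneOn_of_deriv_nonneg (convex_Ici 1)
        · intro x hx
          have : x ≠ 0 := by have := Set.mem_Ici.1 hx; positivity
          exact ContinuousAt.continuousWithinAt (by fun_prop (disch := assumption))
        · intro x hx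
          have : x ≠ 0 := by rw [interior_Ici] at hx; have := Set.mem_Ioi.1 hx; positivity
          exact DifferentiableAt.differentiableWithinAt (by fun_prop (disch := assumption))
        · intro x hx
          rw [interior_Ici] at hx
          have hx1 : 1 < x := hx
          have hx0 : x ≠ 0 := by positivity
          have hd : HasDerivAt (fun u : ℝ => (u - 1 / u) / 2 - Real.log u)
              ((1 - -(x ^ 2)⁻¹) / 2 - x⁻¹) x := by
            have := (((hasDerivAt_id x).sub (hasDerivAt_inv hx0)).div_const 2).sub
              (Real.hasDerivAt_log hx0)
            refine (this.congr_of_eventuallyEq (Filter.Eventually.of_forall fun u => ?_))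
            simp [one_div]
          rw [hd.deriv]
          have : (1 - -(x ^ 2)⁻¹) / 2 - x⁻¹ = (1 - x⁻¹) ^ 2 / 2 := by field_simp; ring
          rw [this]; positivity
      have := hmono (Set.mem_Ici.2 le_rfl) (Set.mem_Ici.2 hu) hu
      simp at this
      simpa using this
    have h1 := key (1 + y)⁻¹ ((one_le_inv₀ hy1).2 (by linarith))
    rw [Real.log_inv] at h1
    have h2 : y ^ 2 / (2 * (1 + y)) ≤ y ^ 2 / (2 * (1 - g)) :=
      div_le_div_of_nonneg_left (sq_nonneg y) (by linarith) (by linarith)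
    have h3 : ((1 + y)⁻¹ - 1 / (1 + y)⁻¹) / 2 = -y + y ^ 2 / (2 * (1 + y)) := by
      field_simp; ring
    linarith

/-! ### Krichevsky–Trofimov regret and Beta integrals -/

/-- Drives the induction in `mul_log_sub_le_log_Gamma`: with φ this function, passing from l to l +
1 raises right side minus left side there by φ(k + l) - φ(l). Its derivative is log(1 + 1/x) - 1/(x
+ 1/2) ≥ 0. -/
lemma monotoneOn_log_sub_log :
    MonotoneOn (fun m : ℝ => (m + 1) * Real.log (m + 1) - m * Real.log m - Real.log (m + 1 / 2))
      (Set.Ici 0) := by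
  apply monotoneOn_of_deriv_nonneg (convex_Ici 0)
  · intro x hx
    have hx0 : 0 ≤ x := hx
    have h2 : x + 1 / 2 ≠ 0 := by positivity
    refine ContinuousAt.continuousWithinAt ?_
    refine ((Real.continuous_mul_log.comp (continuous_add_const 1)).continuousAt.sub
      Real.continuous_mul_log.continuousAt).sub ?_
    fun_prop (disch := assumption)
  · intro x hx
    rw [interior_Ici] at hx
    have hx0 : 0 < x := hx
    have h2 : x + 1 / 2 ≠ 0 := by positivity
    have h3 : x + 1 ≠ 0 := by positivity
    have h4 := hx0.ne'
    exact DifferentiableAt.differentiableWithinAt (by fun_prop (disch := assumption))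
  · intro x hx
    rw [interior_Ici] at hx
    have hx0 : 0 < x := hx
    have hd : HasDerivAt
        (fun m : ℝ => (m + 1) * Real.log (m + 1) - m * Real.log m - Real.log (m + 1 / 2))
        ((Real.log (x + 1) + 1) - (Real.log x + 1) - (x + 1 / 2)⁻¹) x := by
      refine (HasDerivAt.sub ?_ (Real.hasDerivAt_mul_log hx0.ne')).sub ?_
      · exact (Real.hasDerivAt_mul_log (by positivity)).comp_add_const x 1
      · exact (Real.hasDerivAt_log (by positivity)).comp_add_const x (1 / 2)
    rw [hd.deriv]
    have h := Real.le_log_one_add_of_nonneg (x := 1 / x) (by positivity)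
    rw [show 1 + 1 / x = (x + 1) / x by field_simp, Real.log_div (by positivity) hx0.ne'] at h
    have : 2 * (1 / x) / (1 / x + 2) = (x + 1 / 2)⁻¹ := by field_simp; ring
    linarith

/-- The maximum likelihood of a binary sequence with `k` ones and `l` zeros is at most its
Krichevsky–Trofimov mixture likelihood up to the factor attained at constant sequences. -/
lemma mul_log_sub_le_log_Gamma (k l : ℕ) :
    (k : ℝ) * Real.log k + l * Real.log l - (k + l) * Real.log (k + l) ≤
      Real.log (Real.Gamma (k + 1 / 2)) + Real.log (Real.Gamma (l + 1 / 2))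
        - Real.log (Real.sqrt Real.pi) - Real.log (Real.Gamma (k + l + 1 / 2)) := by
  induction l with
  | zero =>
    have := Real.Gamma_one_half_eq
    simp only [one_div] at this
    simp [this]
  | succ l ih =>
    have hm := monotoneOn_log_sub_log (a := (l : ℝ)) (b := (k : ℝ) + l)
      (Set.mem_Ici.2 (by positivity)) (Set.mem_Ici.2 (by positivity))
      (by have : (0 : ℝ) ≤ k := by positivity
          linarith)
    simp only at hm
    have h1 : Real.log (Real.Gamma ((l : ℝ) + 1 + 1 / 2))
        = Real.log (l + 1 / 2) + Real.log (Real.Gamma (l + 1 / 2)) := by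
      rw [show (l : ℝ) + 1 + 1 / 2 = (l + 1 / 2) + 1 by ring, Real.Gamma_add_one (by positivity),
        Real.log_mul (by positivity) (Real.Gamma_pos_of_pos (by positivity)).ne']
    have h2 : Real.log (Real.Gamma ((k : ℝ) + (l + 1) + 1 / 2))
        = Real.log (k + l + 1 / 2) + Real.log (Real.Gamma (k + l + 1 / 2)) := by
      rw [show (k : ℝ) + (l + 1) + 1 / 2 = (k + l + 1 / 2) + 1 by ring,
        Real.Gamma_add_one (by positivity),
        Real.log_mul (by positivity) (Real.Gamma_pos_of_pos (by positivity)).ne']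
    push_cast
    rw [h1, h2]
    rw [show (k : ℝ) + (l + 1) = k + l + 1 by ring]
    linarith

/-- The likelihood is maximal at b = k/(k + l), where its logarithm is the exponent on the right. -/
lemma pow_mul_one_sub_pow_le_exp (k l : ℕ) {b : ℝ} (hb0 : 0 ≤ b) (hb1 : b ≤ 1) :
    b ^ k * (1 - b) ^ l ≤
      Real.exp ((k : ℝ) * Real.log k + l * Real.log l - (k + l) * Real.log (k + l)) := by
  -- The errors x * y - m cancel when the cases x = b and x = 1 - b are added with y = k + l.
  have aux : ∀ (m : ℕ) (x y : ℝ), 0 < x → (m : ℝ) ≤ y → 0 < y →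
      m * Real.log x ≤ m * Real.log m - m * Real.log y + (x * y - m) := by
    intro m x y hx hmy hy
    rcases Nat.eq_zero_or_pos m with rfl | hm
    · simp; positivity
    · have hm' : (0 : ℝ) < m := by exact_mod_cast hm
      have := Real.log_le_sub_one_of_pos (x := x * y / m) (by positivity)
      rw [Real.log_div (by positivity) hm'.ne', Real.log_mul hx.ne' hy.ne'] at this
      have h2 := mul_le_mul_of_nonneg_left this hm'.le
      have h3 : (m : ℝ) * (x * y / m - 1) = x * y - m := by field_simp
      linarith
  rcases Nat.eq_zero_or_pos k with rfl | hk
  · simpa using pow_le_one₀ (by linarith) (by linarith)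
  rcases Nat.eq_zero_or_pos l with rfl | hl
  · simpa using pow_le_one₀ hb0 hb1
  rcases hb0.eq_or_lt with rfl | hb0
  · simp [hk.ne']; positivity
  rcases hb1.eq_or_lt with rfl | hb1
  · simp [hl.ne']; positivity
  have h1b : 0 < 1 - b := by linarith
  rw [← Real.exp_log (show 0 < b ^ k * (1 - b) ^ l by positivity)]
  apply Real.exp_le_exp.2
  rw [Real.log_mul (by positivity) (by positivity), Real.log_pow, Real.log_pow]
  have hk' : (0 : ℝ) < k := by exact_mod_cast hk
  have hl' : (0 : ℝ) < l := by exact_mod_cast hl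
  have h1 := aux k b (k + l) hb0 (by linarith) (by linarith)
  have h2 := aux l (1 - b) (k + l) h1b (by linarith) (by linarith)
  nlinarith

/-- The worst-case regret factor `√π Γ(n+1) / Γ(n+1/2)` of the `Beta(1/2, 1/2)` mixture. -/
noncomputable def regretFactor (n : ℕ) : ℝ :=
  Real.sqrt Real.pi * Real.Gamma ((n : ℝ) + 1) / Real.Gamma ((n : ℝ) + 1 / 2)

lemma regretFactor_pos (n : ℕ) : 0 < regretFactor n := by
  have h1 : 0 < Real.Gamma ((n : ℝ) + 1) := Real.Gamma_pos_of_pos (by positivity)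
  have h2 : 0 < Real.Gamma ((n : ℝ) + 1 / 2) := Real.Gamma_pos_of_pos (by positivity)
  unfold regretFactor
  positivity

lemma pow_mul_one_sub_pow_le_beta (k l : ℕ) {b : ℝ} (hb0 : 0 ≤ b) (hb1 : b ≤ 1) :
    b ^ k * (1 - b) ^ l ≤
      regretFactor (k + l) * (beta (k + 1 / 2) (l + 1 / 2) / beta (1 / 2) (1 / 2)) := by
  refine (pow_mul_one_sub_pow_le_exp k l hb0 hb1).trans
    ((Real.exp_le_exp.2 (mul_log_sub_le_log_Gamma k l)).trans_eq ?_)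
  have h1 : 0 < Real.Gamma ((k : ℝ) + 1 / 2) := Real.Gamma_pos_of_pos (by positivity)
  have h2 : 0 < Real.Gamma ((l : ℝ) + 1 / 2) := Real.Gamma_pos_of_pos (by positivity)
  have h3 : 0 < Real.Gamma ((k : ℝ) + l + 1 / 2) := Real.Gamma_pos_of_pos (by positivity)
  have h4 : 0 < Real.Gamma ((k : ℝ) + l + 1) := Real.Gamma_pos_of_pos (by positivity)
  have h5 : 0 < Real.sqrt Real.pi := Real.sqrt_pos.2 Real.pi_pos
  rw [Real.exp_sub, Real.exp_sub, Real.exp_add, Real.exp_log h1, Real.exp_log h2, Real.exp_log h3,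
    Real.exp_log h5]
  have h6 : beta (1 / 2) (1 / 2) = Real.sqrt Real.pi * Real.sqrt Real.pi := by
    rw [beta, Real.Gamma_one_half_eq]; norm_num
  rw [h6, regretFactor, beta]
  push_cast
  rw [show (k : ℝ) + 1 / 2 + (l + 1 / 2) = k + l + 1 by ring]
  field_simp

/-- Conjugacy: the likelihood times the Beta(1/2, 1/2) density is a multiple of the Beta(k + 1/2, l
+ 1/2) density. -/
lemma lintegral_pow_mul_one_sub_pow_betaMeasure (k l : ℕ) :
    ∫⁻ b, ENNReal.ofReal (b ^ k * (1 - b) ^ l) ∂(betaMeasure (1 / 2) (1 / 2)) =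
      ENNReal.ofReal (beta (k + 1 / 2) (l + 1 / 2) / beta (1 / 2) (1 / 2)) := by
  have hpos : 0 < beta ((k : ℝ) + 1 / 2) (l + 1 / 2) := beta_pos (by positivity) (by positivity)
  have hpos' : 0 < beta (1 / 2) (1 / 2) := beta_pos (by positivity) (by positivity)
  have hm : ∀ a c : ℝ, Measurable (betaPDF a c) := fun a c =>
    (measurable_betaPDFReal a c).ennreal_ofReal
  rw [betaMeasure, lintegral_withDensity_eq_lintegral_mul _ (hm _ _) (by fun_prop)]
  have : ∀ b : ℝ, (betaPDF (1 / 2) (1 / 2) * fun b : ℝ => ENNReal.ofReal (b ^ k * (1 - b) ^ l)) b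
      = ENNReal.ofReal (beta (k + 1 / 2) (l + 1 / 2) / beta (1 / 2) (1 / 2))
        * betaPDF (k + 1 / 2) (l + 1 / 2) b := by
    intro b
    simp only [Pi.mul_apply]
    by_cases hb : 0 < b ∧ b < 1
    · obtain ⟨hb0, hb1⟩ := hb
      have h1b : 0 < 1 - b := by linarith
      rw [betaPDF_of_pos_lt_one hb0 hb1, betaPDF_of_pos_lt_one hb0 hb1,
        ← ENNReal.ofReal_mul (by positivity), ← ENNReal.ofReal_mul (by positivity)]
      congr 1
      rw [show (k : ℝ) + 1 / 2 - 1 = (1 / 2 - 1) + k by ring,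
        show (l : ℝ) + 1 / 2 - 1 = (1 / 2 - 1) + l by ring, Real.rpow_add hb0, Real.rpow_add h1b,
        Real.rpow_natCast, Real.rpow_natCast]
      have h := hpos.ne'
      generalize beta ((k : ℝ) + 1 / 2) (l + 1 / 2) = B at h ⊢
      field_simp
    · simp [betaPDF_eq, if_neg hb]
  simp_rw [this]
  rw [lintegral_const_mul _ (hm _ _), lintegral_betaPDF_eq_one (by positivity) (by positivity),
    mul_one]

lemma ae_betaMeasure_mem_Ioo : ∀ᵐ b ∂(betaMeasure (1 / 2) (1 / 2)), b ∈ Set.Ioo (0 : ℝ) 1 := by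
  rw [betaMeasure, ae_withDensity_iff
    (show Measurable (betaPDF (1 / 2) (1 / 2)) from (measurable_betaPDFReal _ _).ennreal_ofReal)]
  refine Filter.Eventually.of_forall fun b hb => ?_
  by_contra h
  exact hb (by simp only [betaPDF_eq]; rw [if_neg (show ¬(0 < b ∧ b < 1) from h)]; simp)

/-! ### Cover's universal portfolio -/

/-- The wealth of the constant rebalanced portfolio `b` on two assets with price relatives
`x i` and `y i`. -/
noncomputable def portfolioWealth {n : ℕ} (x y : Fin n → ℝ≥0∞) (b : ℝ) : ℝ≥0∞ :=
  ∏ i, (ENNReal.ofReal b * x i + ENNReal.ofReal (1 - b) * y i)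

/-- Expands wealth as a nonnegative combination of binary likelihoods, so that the regret bound for
binary sequences applies term by term. -/
lemma portfolioWealth_eq_sum {n : ℕ} (x y : Fin n → ℝ≥0∞) {b : ℝ} (hb : b ∈ Set.Icc (0 : ℝ) 1) :
    portfolioWealth x y b = ∑ t ∈ (Finset.univ : Finset (Fin n)).powerset,
      ENNReal.ofReal (b ^ t.card * (1 - b) ^ (n - t.card)) *
        ((∏ i ∈ t, x i) * ∏ i ∈ Finset.univ \ t, y i) := by
  have h1b : 0 ≤ 1 - b := by linarith [hb.2]
  rw [portfolioWealth, Finset.prod_add]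
  refine Finset.sum_congr rfl fun t _ => ?_
  rw [Finset.prod_mul_distrib, Finset.prod_mul_distrib, Finset.prod_const, Finset.prod_const,
    ENNReal.ofReal_mul (pow_nonneg hb.1 _), ENNReal.ofReal_pow hb.1, ENNReal.ofReal_pow h1b,
    Finset.card_sdiff_of_subset (Finset.subset_univ t), Finset.card_univ, Fintype.card_fin]
  ring

/-- The universal portfolio of Cover and Ordentlich competes with every constant rebalanced
portfolio. -/
lemma portfolioWealth_le_lintegral {n : ℕ} (x y : Fin n → ℝ≥0∞) {b : ℝ}
    (hb : b ∈ Set.Icc (0 : ℝ) 1) :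
    portfolioWealth x y b ≤
      ENNReal.ofReal (regretFactor n) *
        ∫⁻ b, portfolioWealth x y b ∂(betaMeasure (1 / 2) (1 / 2)) := by
  have h1 : ∫⁻ b, portfolioWealth x y b ∂(betaMeasure (1 / 2) (1 / 2)) =
      ∑ t ∈ (Finset.univ : Finset (Fin n)).powerset,
      ENNReal.ofReal (beta (t.card + 1 / 2) ((n - t.card : ℕ) + 1 / 2) / beta (1 / 2) (1 / 2)) *
        ((∏ i ∈ t, x i) * ∏ i ∈ Finset.univ \ t, y i) := by
    rw [lintegral_congr_ae (ae_betaMeasure_mem_Ioo.mono fun b hb =>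
      portfolioWealth_eq_sum x y ⟨hb.1.le, hb.2.le⟩)]
    rw [lintegral_finsetSum _ (fun t _ => by fun_prop)]
    refine Finset.sum_congr rfl fun t _ => ?_
    rw [lintegral_mul_const _ (by fun_prop), lintegral_pow_mul_one_sub_pow_betaMeasure]
  rw [h1, portfolioWealth_eq_sum x y hb, Finset.mul_sum]
  refine Finset.sum_le_sum fun t _ => ?_
  rw [← mul_assoc (ENNReal.ofReal (regretFactor n)), ← ENNReal.ofReal_mul (regretFactor_pos n).le]
  refine mul_le_mul' (ENNReal.ofReal_le_ofReal ?_) le_rfl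
  have h := pow_mul_one_sub_pow_le_beta t.card (n - t.card) hb.1 hb.2
  have ht : t.card ≤ n := by simpa using Finset.card_le_univ t
  rwa [Nat.add_sub_cancel' ht] at h

/-- Serves the degenerate means 0 and 1, where a price relative can be a positive number over zero;
b = 1/2 keeps all other factors nonzero, so the infinity survives. -/
lemma portfolioWealth_half_eq_top {n : ℕ} {x y : Fin n → ℝ≥0∞} {j : Fin n}
    (hj : x j = ⊤ ∨ y j = ⊤) (h : ∀ i, x i ≠ 0 ∨ y i ≠ 0) :
    portfolioWealth x y (1 / 2) = ⊤ := by
  have hhalf : ENNReal.ofReal (1 / 2) ≠ 0 := by simp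
  have hhalf' : ENNReal.ofReal (1 - 1 / 2) ≠ 0 := by norm_num
  rw [portfolioWealth, ← Finset.mul_prod_erase _ _ (Finset.mem_univ j)]
  have h1 : ENNReal.ofReal (1 / 2) * x j + ENNReal.ofReal (1 - 1 / 2) * y j = ⊤ := by
    rcases hj with hj | hj
    · rw [hj, ENNReal.mul_top hhalf, top_add]
    · rw [hj, ENNReal.mul_top hhalf', add_top]
  rw [h1, ENNReal.top_mul]
  refine Finset.prod_ne_zero_iff.2 fun i _ hi => ?_
  rw [add_eq_zero, mul_eq_zero, mul_eq_zero] at hi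
  rcases h i with hx | hy
  · exact hi.1.elim hhalf hx
  · exact hi.2.elim hhalf' hy

/-! ### The empirical Bernstein exponent as a lower bound on log-wealth -/

lemma empMean_mem_Icc {α β : Type*} {f : α → β → ℝ} (hf : ∀ θ x, f θ x ∈ Set.Icc (0 : ℝ) 1)
    {n : ℕ} (x : Fin n → β) (θ : α) : empMean f x θ ∈ Set.Icc (0 : ℝ) 1 := by
  have h0 : 0 ≤ ∑ i, f θ (x i) := Finset.sum_nonneg fun i _ => (hf _ _).1
  have h1 : ∑ i, f θ (x i) ≤ n := by
    simpa using Finset.sum_le_sum fun i (_ : i ∈ Finset.univ) => (hf θ (x i)).2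
  rw [empMean]
  refine ⟨by positivity, ?_⟩
  rw [one_div_mul_eq_div]
  exact div_le_one_of_le₀ h1 (by positivity)

/-- The empirical Bernstein exponent, with betting fraction `g`, of a sample `a` against the mean
`m`. -/
noncomputable def bernsteinExponent {n : ℕ} (g m : ℝ) (a : Fin n → ℝ) : ℝ :=
  n * (g * ((1 / (n : ℝ)) * ∑ i, a i - m)
    - g ^ 2 / (2 * (1 - |g|)) * ((1 / (n : ℝ)) * ∑ i, (a i - (1 / (n : ℝ)) * ∑ j, a j) ^ 2))

lemma bernsteinExponent_eq {Θ 𝒳 : Type*} (f : Θ → 𝒳 → ℝ) (m : Θ → ℝ) {n : ℕ}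
    (x : Fin n → 𝒳) (g : ℝ) (θ : Θ) :
    bernsteinExponent g (m θ) (fun i => f θ (x i)) =
      n * (g * (empMean f x θ - m θ)
        - g ^ 2 / (2 * (1 - |g|)) * ((1 / (n : ℝ)) * ∑ i, (f θ (x i) - empMean f x θ) ^ 2)) := rfl

lemma mean_sq_mem_Icc {Θ 𝒳 : Type*} {f : Θ → 𝒳 → ℝ}
    (hf01 : ∀ θ x, f θ x ∈ Set.Icc (0 : ℝ) 1) {n : ℕ} (x : Fin n → 𝒳) (θ : Θ) :
    (1 / (n : ℝ)) * ∑ i, (f θ (x i) - empMean f x θ) ^ 2 ∈ Set.Icc (0 : ℝ) 1 := by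
  have hc := empMean_mem_Icc hf01 x θ
  exact empMean_mem_Icc (f := fun (_ : Unit) (i : Fin n) => (f θ (x i) - empMean f x θ) ^ 2)
    (fun _ i => ⟨sq_nonneg _, by
      have := hf01 θ (x i)
      rw [sq_le_one_iff_abs_le_one, abs_le]
      exact ⟨by linarith [this.1, hc.2], by linarith [this.2, hc.1]⟩⟩) id ()

/-- The portfolio b = m(1 + λ(1 - m)) has one-step factor 1 + λ(a - m). Taking λ = g/D makes it (1 +
g(a - c))/D, centred at the empirical mean c. Then log D ≤ D - 1 supplies the gain g(c - m), and the
quadratic bound on log(1 + g(a - c)) supplies the variance term. -/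
lemma exp_bernsteinExponent_le_portfolioWealth {n : ℕ} (hn : 0 < n) {a : Fin n → ℝ}
    (ha : ∀ i, a i ∈ Set.Icc (0 : ℝ) 1) {m g : ℝ} (hm0 : 0 < m) (hm1 : m < 1) (hg : |g| < 1) :
    ∃ b ∈ Set.Icc (0 : ℝ) 1, ENNReal.ofReal (Real.exp (bernsteinExponent g m a)) ≤
      portfolioWealth (fun i => ENNReal.ofReal (a i) / ENNReal.ofReal m)
        (fun i => ENNReal.ofReal (1 - a i) / ENNReal.ofReal (1 - m)) b := by
  have hn' : (0 : ℝ) < n := by exact_mod_cast hn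
  set c := (1 / (n : ℝ)) * ∑ i, a i with hc
  have hc01 : c ∈ Set.Icc (0 : ℝ) 1 :=
    empMean_mem_Icc (f := fun (_ : Unit) (i : Fin n) => a i) (fun _ i => ha i) id ()
  obtain ⟨hc0, hc1⟩ := hc01
  obtain ⟨hg1, hg2⟩ := abs_lt.1 hg
  have hm1' : 0 < 1 - m := by linarith
  have hP : 0 < 1 + g * (1 - c) := by nlinarith
  have hQ : 0 < 1 - g * c := by nlinarith
  set D := 1 - g * (c - m) with hD
  have hDpos : 0 < D := by
    have : D = (1 - m) * (1 - g * c) + m * (1 + g * (1 - c)) := by rw [hD]; ring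
    rw [this]; positivity
  have hb : m * (1 + g / D * (1 - m)) = m * (1 + g * (1 - c)) / D := by
    rw [hD] at hDpos ⊢; field_simp; ring
  have h1b : 1 - m * (1 + g / D * (1 - m)) = (1 - m) * (1 - g * c) / D := by
    rw [hD] at hDpos ⊢; field_simp; ring
  have hb0 : 0 ≤ m * (1 + g / D * (1 - m)) := by rw [hb]; positivity
  have hb1 : 0 ≤ 1 - m * (1 + g / D * (1 - m)) := by rw [h1b]; positivity
  refine ⟨m * (1 + g / D * (1 - m)), ⟨hb0, by linarith⟩, ?_⟩
  have hfac : ∀ i, ENNReal.ofReal (Real.exp (g * (a i - c)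
        - (g * (a i - c)) ^ 2 / (2 * (1 - |g|)) + g * (c - m))) ≤
      ENNReal.ofReal (m * (1 + g / D * (1 - m))) * (ENNReal.ofReal (a i) / ENNReal.ofReal m)
      + ENNReal.ofReal (1 - m * (1 + g / D * (1 - m)))
        * (ENNReal.ofReal (1 - a i) / ENNReal.ofReal (1 - m)) := by
    intro i
    obtain ⟨hi0, hi1⟩ := ha i
    have hi1' : 0 ≤ 1 - a i := by linarith
    rw [← ENNReal.ofReal_div_of_pos hm0, ← ENNReal.ofReal_div_of_pos hm1',
      ← ENNReal.ofReal_mul hb0, ← ENNReal.ofReal_mul hb1,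
      ← ENNReal.ofReal_add (by positivity) (by positivity)]
    apply ENNReal.ofReal_le_ofReal
    have hy : -|g| ≤ g * (a i - c) := by
      have h1 : |g * (a i - c)| ≤ |g| := by
        rw [abs_mul]
        exact mul_le_of_le_one_right (abs_nonneg g) (abs_le.2 ⟨by linarith, by linarith⟩)
      linarith [(abs_le.1 h1).1]
    have hlog := sub_sq_div_le_log_one_add (abs_nonneg g) hg hy
    have hpos : 0 < 1 + g * (a i - c) := by linarith
    have hlogD := Real.log_le_sub_one_of_pos hDpos
    have heq : m * (1 + g / D * (1 - m)) * (a i / m)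
        + (1 - m * (1 + g / D * (1 - m))) * ((1 - a i) / (1 - m)) = (1 + g * (a i - c)) / D := by
      rw [h1b, hb]; field_simp; ring
    rw [heq, ← Real.exp_log (div_pos hpos hDpos), Real.log_div hpos.ne' hDpos.ne']
    apply Real.exp_le_exp.2
    linarith
  refine le_trans (le_of_eq ?_) (Finset.prod_le_prod' fun i _ => hfac i)
  rw [← ENNReal.ofReal_prod_of_nonneg (fun i _ => (Real.exp_pos _).le), ← Real.exp_sum]
  congr 2
  -- Centring at the empirical mean kills the linear terms and leaves the sample variance.
  have hsum : ∑ i, (a i - c) = 0 := by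
    rw [Finset.sum_sub_distrib]
    simp only [Finset.sum_const, Finset.card_univ, Fintype.card_fin, nsmul_eq_mul]
    rw [hc]; field_simp; ring
  simp only [Finset.sum_add_distrib, Finset.sum_sub_distrib, ← Finset.mul_sum, mul_pow,
    ← Finset.sum_div, hsum, Finset.sum_const, Finset.card_univ, Fintype.card_fin, nsmul_eq_mul,
    bernsteinExponent, ← hc]
  have hg' : 1 - |g| ≠ 0 := by linarith
  field_simp
  ring

lemma exp_bernsteinExponent_le {n : ℕ} (hn : 0 < n) {a : Fin n → ℝ}
    (ha : ∀ i, a i ∈ Set.Icc (0 : ℝ) 1) {m g : ℝ} (hm : m ∈ Set.Icc (0 : ℝ) 1) (hg : |g| < 1) :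
    ENNReal.ofReal (Real.exp (bernsteinExponent g m a)) ≤ ENNReal.ofReal (regretFactor n) *
      ∫⁻ b, portfolioWealth (fun i => ENNReal.ofReal (a i) / ENNReal.ofReal m)
        (fun i => ENNReal.ofReal (1 - a i) / ENNReal.ofReal (1 - m)) b
        ∂(betaMeasure (1 / 2) (1 / 2)) := by
  suffices h : ∃ b ∈ Set.Icc (0 : ℝ) 1, ENNReal.ofReal (Real.exp (bernsteinExponent g m a)) ≤
      portfolioWealth (fun i => ENNReal.ofReal (a i) / ENNReal.ofReal m)
        (fun i => ENNReal.ofReal (1 - a i) / ENNReal.ofReal (1 - m)) b by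
    obtain ⟨b, hb, h⟩ := h
    exact h.trans (portfolioWealth_le_lintegral _ _ hb)
  have hn' : (n : ℝ) ≠ 0 := by exact_mod_cast hn.ne'
  -- At a degenerate mean, either some observation differs from it and b = 1/2 has infinite wealth,
  -- or all agree with it and a pure portfolio has wealth 1, matching exponent 0.
  rcases hm.1.eq_or_lt with rfl | hm0
  · by_cases h : ∃ j, 0 < a j
    · obtain ⟨j, hj⟩ := h
      refine ⟨1 / 2, by norm_num, le_of_le_of_eq le_top (portfolioWealth_half_eq_top (j := j)
        (Or.inl ?_) fun i => ?_).symm⟩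
      · simp [ENNReal.div_zero, hj]
      · rcases (ha i).1.eq_or_lt with hi | hi
        · right; simp [← hi]
        · left; simp [hi]
    · push Not at h
      obtain rfl : a = 0 := funext fun i => le_antisymm (h i) (ha i).1
      exact ⟨0, by norm_num, by simp [bernsteinExponent, portfolioWealth]⟩
  rcases hm.2.eq_or_lt with rfl | hm1
  · by_cases h : ∃ j, a j < 1
    · obtain ⟨j, hj⟩ := h
      refine ⟨1 / 2, by norm_num, le_of_le_of_eq le_top (portfolioWealth_half_eq_top (j := j)
        (Or.inr ?_) fun i => ?_).symm⟩
      · simp [ENNReal.div_zero, hj]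
      · rcases (ha i).2.eq_or_lt with hi | hi
        · left; simp [hi]
        · right; simp [hi]
    · push Not at h
      obtain rfl : a = 1 := funext fun i => le_antisymm (ha i).2 (h i)
      exact ⟨1, by norm_num, by simp [bernsteinExponent, portfolioWealth, hn']⟩
  exact exp_bernsteinExponent_le_portfolioWealth hn ha hm0 hm1 hg

/-! ### Ville's inequality for mixture wealth -/

section Ville

variable {Ω β Z : Type*} [MeasurableSpace Ω] [MeasurableSpace β] [MeasurableSpace Z]

/-- The mixture over `ν` of the products of the factors `g z` along a finite sequence. -/
noncomputable def mixtureWealth (ν : Measure Z) (g : Z → β → ℝ≥0∞) {n : ℕ} (x : Fin n → β) :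
    ℝ≥0∞ :=
  ∫⁻ z, ∏ i, g z (x i) ∂ν

lemma measurable_prod_factor {g : Z → β → ℝ≥0∞} (hg : Measurable (Function.uncurry g)) (n : ℕ) :
    Measurable fun p : (Fin n → β) × Z => ∏ i, g p.2 (p.1 i) :=
  Finset.measurable_fun_prod _ fun i _ =>
    hg.comp (measurable_snd.prodMk ((measurable_pi_apply i).comp measurable_fst))

lemma measurable_mixtureWealth (ν : Measure Z) [SFinite ν] {g : Z → β → ℝ≥0∞}
    (hg : Measurable (Function.uncurry g)) (n : ℕ) :
    Measurable fun x : Fin n → β => mixtureWealth ν g x :=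
  (measurable_prod_factor hg n).lintegral_prod_right'

lemma indepFun_initial_segment {Pr : Measure Ω} {X : ℕ → Ω → β} (hX : ∀ i, Measurable (X i))
    (hindep : iIndepFun X Pr) (n : ℕ) :
    IndepFun (fun ω (i : Fin n) => X i ω) (X n) Pr := by
  have h := hindep.indepFun_finset (Finset.range n) {n} (by simp) hX
  exact h.comp
    (φ := fun (x : Finset.range n → β) (i : Fin n) => x ⟨i, Finset.mem_range.2 i.2⟩)
    (ψ := fun x : ({n} : Finset ℕ) → β => x ⟨n, Finset.mem_singleton_self n⟩)
    (measurable_pi_lambda _ fun i => measurable_pi_apply _) (measurable_pi_apply _)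

/-- The mixture wealth of an independent sequence under factors of mean at most one is a
supermartingale. -/
lemma setLIntegral_mixtureWealth_succ_le {Pr : Measure Ω} [IsProbabilityMeasure Pr]
    {X : ℕ → Ω → β} (hX : ∀ i, Measurable (X i)) (hindep : iIndepFun X Pr)
    (ν : Measure Z) [SFinite ν] {g : Z → β → ℝ≥0∞} (hg : Measurable (Function.uncurry g))
    (hmean : ∀ᵐ z ∂ν, ∀ i, ∫⁻ ω, g z (X i ω) ∂Pr ≤ 1) {n : ℕ} {S : Set (Fin n → β)}
    (hS : MeasurableSet S) :
    ∫⁻ ω in (fun ω (i : Fin n) => X i ω) ⁻¹' S,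
        mixtureWealth ν g (fun i : Fin (n + 1) => X i ω) ∂Pr ≤
      ∫⁻ ω in (fun ω (i : Fin n) => X i ω) ⁻¹' S,
        mixtureWealth ν g (fun i : Fin n => X i ω) ∂Pr := by
  have hT : Measurable fun ω (i : Fin n) => X i ω := measurable_pi_lambda _ fun i => hX i
  have hgz : ∀ z, Measurable (g z) := fun z => hg.comp measurable_prodMk_left
  have hswap : ∀ (m : ℕ) (μ : Measure Ω) [SFinite μ],
      ∫⁻ ω, ∫⁻ z, ∏ i : Fin m, g z (X i ω) ∂ν ∂μ = ∫⁻ z, ∫⁻ ω, ∏ i : Fin m, g z (X i ω) ∂μ ∂ν :=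
    fun m μ _ => lintegral_lintegral_swap ((measurable_prod_factor hg m).comp
      (((measurable_pi_lambda _ fun i : Fin m => hX i).comp measurable_fst).prodMk
        measurable_snd)).aemeasurable
  unfold mixtureWealth
  -- By Tonelli it suffices to fix z; the new factor is then independent of the past product
  -- restricted to S.
  rw [hswap, hswap]
  refine lintegral_mono_ae (hmean.mono fun z hz => ?_)
  have hφ : Measurable (S.indicator fun x : Fin n → β => ∏ i, g z (x i)) :=
    (Finset.measurable_fun_prod _ fun i _ =>
      (hgz z).comp (measurable_pi_apply i)).indicator hS
  have h := lintegral_mul_eq_lintegral_mul_lintegral_of_indepFun (hφ.comp hT)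
    ((hgz z).comp (hX n)) ((indepFun_initial_segment hX hindep n).comp hφ (hgz z))
  rw [← lintegral_indicator (hT hS), ← lintegral_indicator (hT hS)]
  calc _ = ∫⁻ ω, ((S.indicator fun x : Fin n → β => ∏ i, g z (x i)) ∘
          (fun ω (i : Fin n) => X i ω) * g z ∘ X n) ω ∂Pr := by
        refine lintegral_congr fun ω => ?_
        by_cases hω : (fun i : Fin n => X i ω) ∈ S
        · rw [Set.indicator_of_mem (by exact hω), Fin.prod_univ_castSucc, Pi.mul_apply,
            Function.comp_apply, Set.indicator_of_mem hω]
          rfl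
        · rw [Set.indicator_of_notMem (by exact hω), Pi.mul_apply, Function.comp_apply,
            Set.indicator_of_notMem hω, zero_mul]
    _ ≤ _ := by
        rw [h]
        exact mul_le_of_le_one_right' (hz n)

/-- **Ville's inequality** for mixtures of products of independent factors of mean at most one. -/
lemma mul_measure_exists_lt_mixtureWealth_le {Pr : Measure Ω} [IsProbabilityMeasure Pr]
    {X : ℕ → Ω → β} (hX : ∀ i, Measurable (X i)) (hindep : iIndepFun X Pr)
    (ν : Measure Z) [IsProbabilityMeasure ν] {g : Z → β → ℝ≥0∞}
    (hg : Measurable (Function.uncurry g))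
    (hmean : ∀ᵐ z ∂ν, ∀ i, ∫⁻ ω, g z (X i ω) ∂Pr ≤ 1) (c : ℝ≥0∞) :
    c * Pr {ω | ∃ n, c < mixtureWealth ν g (fun i : Fin n => X i ω)} ≤ 1 := by
  set M : ℕ → Ω → ℝ≥0∞ := fun n ω => mixtureWealth ν g (fun i : Fin n => X i ω) with hM
  have hMm : ∀ n, Measurable (M n) := fun n =>
    (measurable_mixtureWealth ν hg n).comp (measurable_pi_lambda _ fun i => hX i)
  set A : ℕ → Set Ω := fun n => {ω | ∃ k < n, c < M k ω} with hA
  have hAm : ∀ n, MeasurableSet (A n) := fun n => by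
    have : A n = ⋃ k, ⋃ (_ : k < n), {ω | c < M k ω} := by ext; simp [hA]
    rw [this]
    exact MeasurableSet.iUnion fun k => MeasurableSet.iUnion fun _ =>
      measurableSet_lt measurable_const (hMm k)
  have hAsucc : ∀ n, A (n + 1) = A n ∪ {ω | c < M n ω} := fun n => by
    ext ω
    simp only [hA, Set.mem_ofPred_eq, Set.mem_union, Nat.lt_succ_iff_lt_or_eq]
    constructor
    · rintro ⟨k, hk | rfl, h⟩
      · exact Or.inl ⟨k, hk, h⟩
      · exact Or.inr h
    · rintro (⟨k, hk, h⟩ | h)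
      · exact ⟨k, Or.inl hk, h⟩
      · exact ⟨n, Or.inr rfl, h⟩
  have hstep : ∀ n, ∫⁻ ω in (A (n + 1))ᶜ, M (n + 1) ω ∂Pr ≤ ∫⁻ ω in (A (n + 1))ᶜ, M n ω ∂Pr := by
    intro n
    -- Since A (n + 1) involves only M 0, ..., M n, its complement is determined by the first n
    -- observations.
    set S : Set (Fin n → β) :=
      ⋂ k : Fin (n + 1), {x | mixtureWealth ν g
        (fun i : Fin k => x (Fin.castLE (Nat.lt_succ_iff.1 k.2) i)) ≤ c} with hS
    have hSm : MeasurableSet S := MeasurableSet.iInter fun k =>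
      measurableSet_le ((measurable_mixtureWealth ν hg k).comp
        (measurable_pi_lambda _ fun i => measurable_pi_apply _)) measurable_const
    have : (A (n + 1))ᶜ = (fun ω (i : Fin n) => X i ω) ⁻¹' S := by
      ext ω
      simp only [hA, hS, hM, Set.mem_compl_iff, Set.mem_ofPred_eq, Set.mem_preimage, Set.mem_iInter,
        not_exists, not_and, not_lt, Fin.forall_iff]
      rfl
    rw [this]
    exact setLIntegral_mixtureWealth_succ_le hX hindep ν hg hmean hSm
  -- Optional stopping by hand: the wealth counts as c once the level has been crossed and as M n
  -- before.
  have hind : ∀ n, c * Pr (A n) + ∫⁻ ω in (A n)ᶜ, M n ω ∂Pr ≤ 1 := by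
    intro n
    induction n with
    | zero => simp [hA, hM, mixtureWealth]
    | succ n ih =>
      refine le_trans ?_ ih
      have hB : MeasurableSet {ω | c < M n ω} := measurableSet_lt measurable_const (hMm n)
      have h1 : Pr (A (n + 1)) = Pr (A n) + Pr ((A n)ᶜ ∩ {ω | c < M n ω}) := by
        rw [← measure_union _ ((hAm n).compl.inter hB), hAsucc]
        · congr 1
          ext ω
          by_cases h : ω ∈ A n <;> simp [h]
        · exact Set.disjoint_left.2 fun ω h h' => h'.1 h
      have h2 : ∫⁻ ω in (A n)ᶜ, M n ω ∂Pr =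
          ∫⁻ ω in (A n)ᶜ ∩ {ω | c < M n ω}, M n ω ∂Pr + ∫⁻ ω in (A (n + 1))ᶜ, M n ω ∂Pr := by
        rw [← lintegral_inter_add_sdiff (M n) (A n)ᶜ hB, hAsucc]
        congr 3
        ext ω; simp
      have h3 : c * Pr ((A n)ᶜ ∩ {ω | c < M n ω}) ≤
          ∫⁻ ω in (A n)ᶜ ∩ {ω | c < M n ω}, M n ω ∂Pr := by
        rw [← setLIntegral_const]
        exact setLIntegral_mono (hMm n) fun ω hω => hω.2.le
      rw [h1, h2, mul_add, add_assoc]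
      exact add_le_add_right (add_le_add h3 (hstep n)) _
  have hmono : Monotone A := monotone_nat_of_le_succ fun n => by
    rw [hAsucc]; exact Set.subset_union_left
  have hU : {ω | ∃ n, c < M n ω} = ⋃ n, A n := by
    ext ω
    simp only [hA, Set.mem_ofPred_eq, Set.mem_iUnion]
    exact ⟨fun ⟨n, h⟩ => ⟨n + 1, n, n.lt_succ_self, h⟩, fun ⟨_, k, _, h⟩ => ⟨k, h⟩⟩
  rw [hU, hmono.measure_iUnion, ENNReal.mul_iSup]
  exact iSup_le fun n => le_self_add.trans (hind n)

end Ville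

/-! ### Change of measure and optimization of the bet -/

/-- The **Donsker–Varadhan** variational bound for bounded functions. -/
lemma integral_le_klDiv_add_log_integral_exp {α : Type*} [MeasurableSpace α] {Q P : Measure α}
    [IsProbabilityMeasure Q] [IsProbabilityMeasure P]
    (hkl : InformationTheory.klDiv Q P ≠ ⊤) {h : α → ℝ} (hh : Measurable h) {B : ℝ}
    (hB : ∀ a, |h a| ≤ B) :
    ∫ a, h a ∂Q ≤ (InformationTheory.klDiv Q P).toReal + Real.log (∫ a, Real.exp (h a) ∂P) := by
  obtain ⟨hac, hint⟩ := InformationTheory.klDiv_ne_top_iff.1 hkl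
  have hhQ : Integrable h Q :=
    Integrable.of_bound hh.aestronglyMeasurable B (Filter.Eventually.of_forall hB)
  have hexp : Integrable (fun a => Real.exp (h a)) P :=
    Integrable.of_bound hh.exp.aestronglyMeasurable (Real.exp B) (Filter.Eventually.of_forall
      fun a => by
        rw [Real.norm_eq_abs, Real.abs_exp]
        exact Real.exp_le_exp.2 ((le_abs_self _).trans (hB a)))
  -- The bound is nonnegativity of the divergence of Q from P tilted by h.
  have := isProbabilityMeasure_tilted hexp
  have h1 := integral_llr_tilted_right hac hhQ hexp hint
  have h2 := InformationTheory.integral_llr_add_sub_measure_univ_nonneg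
    (hac.trans (absolutelyContinuous_tilted hexp)) (integrable_llr_tilted_right hac hhQ hint hexp)
  have h3 := InformationTheory.toReal_klDiv_of_measure_eq hac (by simp)
  simp at h2
  linarith

/-- The bet g = Δ/(V + |Δ|) gives n|Δ|² ≤ 2c(V + |Δ|), a quadratic inequality in |Δ|. For V = 0 this
g is not admissible unless Δ = 0, and g = ±1/2 suffices. -/
lemma abs_le_sqrt_add_of_forall_bet {n : ℕ} (hn : 1 ≤ n) {c V Δ : ℝ} (hc : 0 ≤ c) (hV : 0 ≤ V)
    (h : ∀ g : ℝ, |g| < 1 → n * (g * Δ - g ^ 2 / (2 * (1 - |g|)) * V) ≤ c) :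
    |Δ| ≤ Real.sqrt (2 * c * V) / Real.sqrt n + 2 * c / n := by
  have hn' : (0 : ℝ) < n := by exact_mod_cast hn
  rw [← Real.sqrt_div' _ hn'.le]
  rcases hV.eq_or_lt with rfl | hV
  · have h1 := h (1 / 2) (by rw [abs_of_pos] <;> norm_num)
    have h2 := h (-(1 / 2)) (by rw [abs_neg, abs_of_pos] <;> norm_num)
    simp only [mul_zero, zero_div, Real.sqrt_zero, zero_add, sub_zero] at h1 h2 ⊢
    rw [le_div_iff₀ hn', abs_eq_max_neg, max_mul_of_nonneg _ _ hn'.le]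
    exact max_le (by linarith) (by linarith)
  have hpos : 0 < V + |Δ| := by positivity
  have habs : |Δ / (V + |Δ|)| = |Δ| / (V + |Δ|) := by rw [abs_div, abs_of_pos hpos]
  have hlt : |Δ / (V + |Δ|)| < 1 := by rw [habs, div_lt_one hpos]; linarith
  have hq := h _ hlt
  have hd : 1 - |Δ| / (V + |Δ|) = V / (V + |Δ|) := by field_simp; ring
  have heq : Δ / (V + |Δ|) * Δ - (Δ / (V + |Δ|)) ^ 2 / (2 * (V / (V + |Δ|))) * V
      = |Δ| ^ 2 / (2 * (V + |Δ|)) := by rw [sq_abs]; field_simp; ring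
  rw [habs, hd, heq, ← mul_div_assoc, div_le_iff₀ (by positivity)] at hq
  set s := Real.sqrt (2 * c * V / n) with hs
  have hs0 : 0 ≤ s := Real.sqrt_nonneg _
  have hs2 : n * (s * s) = 2 * c * V := by
    rw [hs, Real.mul_self_sqrt (by positivity)]; field_simp
  have ht : n * (2 * c / n) = 2 * c := by field_simp
  set t := 2 * c / n
  have ht0 : 0 ≤ t := by positivity
  by_contra! hlt
  have h1 : s * s < |Δ| * (|Δ| - t) := by nlinarith
  nlinarith

/-- The denominators of the width are at most √n and n, so the optimized bound implies it; for C = ∞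
the width is infinite. -/
lemma ofReal_abs_le_bernsteinWidth {n : ℕ} (hn : 1 ≤ n) {C : ℝ≥0∞} {V Δ : ℝ} (hV : 0 ≤ V)
    (h : C ≠ ⊤ → ∀ g : ℝ, |g| < 1 →
      n * (g * Δ - g ^ 2 / (2 * (1 - |g|)) * V) ≤ C.toReal) :
    ENNReal.ofReal |Δ| ≤ bernsteinWidth n C (ENNReal.ofReal V) := by
  have hn' : (0 : ℝ) < n := by exact_mod_cast hn
  by_cases hC : C = ⊤
  · subst hC
    rw [bernsteinWidth, ENNReal.mul_top (by norm_num), ENNReal.sub_top,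
      ENNReal.div_zero (by norm_num), add_top]
    exact le_top
  have hc : 0 ≤ C.toReal := ENNReal.toReal_nonneg
  have hb := abs_le_sqrt_add_of_forall_bet hn hc hV (h hC)
  have h2C : 2 * C = ENNReal.ofReal (2 * C.toReal) := by
    rw [ENNReal.ofReal_mul (by norm_num), ENNReal.ofReal_toReal hC]; norm_num
  have hnE : (n : ℝ≥0∞) = ENNReal.ofReal n := by simp
  calc ENNReal.ofReal |Δ| ≤ _ := ENNReal.ofReal_le_ofReal hb
    _ = (2 * C * ENNReal.ofReal V) ^ (1 / 2 : ℝ) / (n : ℝ≥0∞) ^ (1 / 2 : ℝ) + 2 * C / n := by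
        rw [ENNReal.ofReal_add (by positivity) (by positivity),
          ENNReal.ofReal_div_of_pos (Real.sqrt_pos.2 hn'), ENNReal.ofReal_div_of_pos hn', h2C,
          ← ENNReal.ofReal_mul (by positivity), hnE, Real.sqrt_eq_rpow, Real.sqrt_eq_rpow,
          ENNReal.ofReal_rpow_of_nonneg (by positivity) (by norm_num),
          ENNReal.ofReal_rpow_of_nonneg hn'.le (by norm_num)]
    _ ≤ _ := add_le_add (ENNReal.div_le_div_left tsub_le_self _)
        (ENNReal.div_le_div_left tsub_le_self _)

/-! ### From wealth to the PAC-Bayes bound -/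

section Main

variable {Ω 𝒳 Θ : Type*} [MeasurableSpace Ω] [MeasurableSpace 𝒳] [MeasurableSpace Θ]

lemma measurable_section {f : Θ → 𝒳 → ℝ} (hf : Measurable (Function.uncurry f)) (x : 𝒳) :
    Measurable fun θ => f θ x :=
  hf.comp (measurable_id.prodMk measurable_const)

lemma measurable_empMean {f : Θ → 𝒳 → ℝ} (hf : Measurable (Function.uncurry f)) {n : ℕ}
    (x : Fin n → 𝒳) : Measurable (empMean f x) :=
  (Finset.measurable_fun_sum _ fun i _ => measurable_section hf (x i)).const_mul _

lemma measurable_sum_sq {f : Θ → 𝒳 → ℝ} (hf : Measurable (Function.uncurry f)) {n : ℕ}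
    (x : Fin n → 𝒳) : Measurable fun θ => ∑ i, (f θ (x i) - empMean f x θ) ^ 2 :=
  Finset.measurable_fun_sum _ fun i _ =>
    ((measurable_section hf (x i)).sub (measurable_empMean hf x)).pow_const 2

lemma measurable_mean (Pr : Measure Ω) [SFinite Pr] {Y : Ω → 𝒳} (hY : Measurable Y)
    {f : Θ → 𝒳 → ℝ} (hf : Measurable (Function.uncurry f)) : Measurable (mean Pr Y f) := by
  have : StronglyMeasurable fun p : Θ × Ω => f p.1 (Y p.2) :=
    (hf.comp (measurable_fst.prodMk (hY.comp measurable_snd))).stronglyMeasurable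
  exact this.integral_prod_right'.measurable

lemma integrable_section (Pr : Measure Ω) [IsProbabilityMeasure Pr] {Y : Ω → 𝒳}
    (hY : Measurable Y) {f : Θ → 𝒳 → ℝ} (hf : Measurable (Function.uncurry f))
    (hf01 : ∀ θ x, f θ x ∈ Set.Icc (0 : ℝ) 1) (θ : Θ) : Integrable (fun ω => f θ (Y ω)) Pr :=
  Integrable.of_bound ((hf.comp measurable_prodMk_left).comp hY).aestronglyMeasurable 1
    (Filter.Eventually.of_forall fun ω => by
      rw [Real.norm_eq_abs, abs_of_nonneg (hf01 _ _).1]; exact (hf01 _ _).2)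

lemma mean_mem_Icc (Pr : Measure Ω) [IsProbabilityMeasure Pr] {Y : Ω → 𝒳} (hY : Measurable Y)
    {f : Θ → 𝒳 → ℝ} (hf : Measurable (Function.uncurry f))
    (hf01 : ∀ θ x, f θ x ∈ Set.Icc (0 : ℝ) 1) (θ : Θ) : mean Pr Y f θ ∈ Set.Icc (0 : ℝ) 1 := by
  refine ⟨integral_nonneg fun ω => (hf01 _ _).1, ?_⟩
  have := integral_mono (integrable_section Pr hY hf hf01 θ) (integrable_const 1)
    fun ω => (hf01 θ (Y ω)).2
  simpa [mean] using this

/-- The one-step wealth factor of the portfolio `z.2` betting against the mean `m z.1`. -/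
noncomputable def wealthFactor (f : Θ → 𝒳 → ℝ) (m : Θ → ℝ) (z : Θ × ℝ) (x : 𝒳) : ℝ≥0∞ :=
  ENNReal.ofReal z.2 * (ENNReal.ofReal (f z.1 x) / ENNReal.ofReal (m z.1))
    + ENNReal.ofReal (1 - z.2) * (ENNReal.ofReal (1 - f z.1 x) / ENNReal.ofReal (1 - m z.1))

lemma measurable_wealthFactor {f : Θ → 𝒳 → ℝ} (hf : Measurable (Function.uncurry f))
    {m : Θ → ℝ} (hm : Measurable m) : Measurable (Function.uncurry (wealthFactor f m)) := by
  have h1 : Measurable fun p : (Θ × ℝ) × 𝒳 => f p.1.1 p.2 :=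
    hf.comp ((measurable_fst.comp measurable_fst).prodMk measurable_snd)
  have h2 : Measurable fun p : (Θ × ℝ) × 𝒳 => m p.1.1 :=
    hm.comp (measurable_fst.comp measurable_fst)
  unfold wealthFactor Function.uncurry
  fun_prop

lemma lintegral_wealthFactor_le_one (Pr : Measure Ω) [IsProbabilityMeasure Pr] {Y : Ω → 𝒳}
    (hY : Measurable Y) {f : Θ → 𝒳 → ℝ} (hf : Measurable (Function.uncurry f))
    (hf01 : ∀ θ x, f θ x ∈ Set.Icc (0 : ℝ) 1) {z : Θ × ℝ} (hz : z.2 ∈ Set.Ioo (0 : ℝ) 1) :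
    ∫⁻ ω, wealthFactor f (mean Pr Y f) z (Y ω) ∂Pr ≤ 1 := by
  have hm : Measurable fun ω => f z.1 (Y ω) := (hf.comp measurable_prodMk_left).comp hY
  have hint := integrable_section Pr hY hf hf01 z.1
  have h1 : ∫⁻ ω, ENNReal.ofReal (f z.1 (Y ω)) ∂Pr = ENNReal.ofReal (mean Pr Y f z.1) :=
    (ofReal_integral_eq_lintegral_ofReal hint
      (Filter.Eventually.of_forall fun ω => (hf01 _ _).1)).symm
  have h2 : ∫⁻ ω, ENNReal.ofReal (1 - f z.1 (Y ω)) ∂Pr = ENNReal.ofReal (1 - mean Pr Y f z.1) := by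
    have hint' : Integrable (fun ω => 1 - f z.1 (Y ω)) Pr := (integrable_const 1).sub hint
    rw [← ofReal_integral_eq_lintegral_ofReal hint'
      (Filter.Eventually.of_forall fun ω => sub_nonneg.2 (hf01 _ _).2),
      integral_sub (integrable_const 1) hint]
    simp [mean]
  unfold wealthFactor
  simp only [div_eq_mul_inv]
  rw [lintegral_add_left (by fun_prop), lintegral_const_mul _ (by fun_prop),
    lintegral_const_mul _ (by fun_prop), lintegral_mul_const _ (by fun_prop),
    lintegral_mul_const _ (by fun_prop), h1, h2, ← div_eq_mul_inv, ← div_eq_mul_inv]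
  calc _ ≤ ENNReal.ofReal z.2 * 1 + ENNReal.ofReal (1 - z.2) * 1 := by
        -- Only an inequality: at a degenerate mean one quotient is 0/0 = 0.
        gcongr <;> exact ENNReal.div_self_le_one
    _ = 1 := by
        rw [mul_one, mul_one, ← ENNReal.ofReal_add hz.1.le (by linarith [hz.2])]
        simp

/-- A sample on which the mixture wealth is at most `1 / δ` satisfies the linearized bounds for
every posterior `Q`. -/
lemma bet_le_complexity (P₀ Q : Measure Θ) [IsProbabilityMeasure P₀] [IsProbabilityMeasure Q]
    {f : Θ → 𝒳 → ℝ} (hf : Measurable (Function.uncurry f))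
    (hf01 : ∀ θ x, f θ x ∈ Set.Icc (0 : ℝ) 1) {m : Θ → ℝ} (hm : Measurable m)
    (hm01 : ∀ θ, m θ ∈ Set.Icc (0 : ℝ) 1) {δ : ℝ} (hδ : 0 < δ) {n : ℕ} (hn : 1 ≤ n)
    {x : Fin n → 𝒳}
    (hx : mixtureWealth (P₀.prod (betaMeasure (1 / 2) (1 / 2))) (wealthFactor f m) x ≤
      ENNReal.ofReal (1 / δ))
    (hC : complexity n δ Q P₀ ≠ ⊤) {g : ℝ} (hg : |g| < 1) :
    n * (g * (∫ θ, empMean f x θ ∂Q - ∫ θ, m θ ∂Q) - g ^ 2 / (2 * (1 - |g|)) * sampleVar f x Q) ≤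
      (complexity n δ Q P₀).toReal := by
  have : IsProbabilityMeasure (betaMeasure (1 / 2) (1 / 2)) :=
    isProbabilityMeasureBeta (by norm_num) (by norm_num)
  have hkl : InformationTheory.klDiv Q P₀ ≠ ⊤ := fun h => hC (by simp [complexity, h])
  have hKpos := regretFactor_pos n
  set r := g ^ 2 / (2 * (1 - |g|)) with hr
  have hr0 : 0 ≤ r := div_nonneg (sq_nonneg g) (by linarith)
  set h : Θ → ℝ := fun θ => bernsteinExponent g (m θ) (fun i => f θ (x i)) with hh
  have hmh : Measurable h := by
    have h1 := measurable_empMean hf x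
    have h2 := measurable_sum_sq hf x
    simp only [hh, bernsteinExponent_eq]
    fun_prop
  have hbd : ∀ θ, |h θ| ≤ n * (1 + r) := by
    intro θ
    have h1 := empMean_mem_Icc hf01 x θ
    have h2 := mean_sq_mem_Icc hf01 x θ
    have h3 := hm01 θ
    simp only [hh, bernsteinExponent_eq, ← hr]
    rw [abs_mul, abs_of_nonneg (Nat.cast_nonneg n)]
    gcongr
    refine (abs_sub _ _).trans (add_le_add ?_ ?_)
    · rw [abs_mul]
      exact mul_le_one₀ hg.le (abs_nonneg _)
        (abs_le.2 ⟨by linarith [h1.1, h3.2], by linarith [h1.2, h3.1]⟩)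
    · rw [abs_mul, abs_of_nonneg hr0, abs_of_nonneg h2.1]
      exact mul_le_of_le_one_right hr0 h2.2
  have hexp : ∫⁻ θ, ENNReal.ofReal (Real.exp (h θ)) ∂P₀ ≤
      ENNReal.ofReal (regretFactor n * (1 / δ)) := by
    have hmw : Measurable fun z : Θ × ℝ => ∏ i, wealthFactor f m z (x i) :=
      Finset.measurable_fun_prod _ fun i _ =>
        (measurable_wealthFactor hf hm).comp (measurable_id.prodMk measurable_const)
    calc _ ≤ ∫⁻ θ, ENNReal.ofReal (regretFactor n) *
            ∫⁻ b, ∏ i, wealthFactor f m (θ, b) (x i) ∂(betaMeasure (1 / 2) (1 / 2)) ∂P₀ :=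
          lintegral_mono fun θ =>
            exp_bernsteinExponent_le hn (fun i => hf01 θ (x i)) (hm01 θ) hg
      _ = ENNReal.ofReal (regretFactor n) *
            mixtureWealth (P₀.prod (betaMeasure (1 / 2) (1 / 2))) (wealthFactor f m) x := by
          rw [lintegral_const_mul _ hmw.lintegral_prod_right', mixtureWealth,
            lintegral_prod _ hmw.aemeasurable]
      _ ≤ _ := by
          rw [ENNReal.ofReal_mul hKpos.le]
          exact mul_le_mul' le_rfl hx
  have hexp' : ∫ θ, Real.exp (h θ) ∂P₀ ≤ regretFactor n * (1 / δ) := by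
    rw [integral_eq_lintegral_of_nonneg_ae (Filter.Eventually.of_forall fun θ => (Real.exp_pos _).le)
      hmh.exp.aestronglyMeasurable]
    exact ENNReal.toReal_le_of_le_ofReal (by positivity) hexp
  have hpos : 0 < ∫ θ, Real.exp (h θ) ∂P₀ :=
    integral_exp_pos (Integrable.of_bound hmh.exp.aestronglyMeasurable (Real.exp (n * (1 + r)))
      (Filter.Eventually.of_forall fun θ => by
        rw [Real.norm_eq_abs, Real.abs_exp]
        exact Real.exp_le_exp.2 ((le_abs_self _).trans (hbd θ))))
  have hdv := integral_le_klDiv_add_log_integral_exp hkl hmh hbd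
  have hlog := Real.log_le_log hpos hexp'
  rw [Real.log_mul hKpos.ne' (by positivity)] at hlog
  -- Truncation by `ENNReal.ofReal` can only enlarge the complexity, so the signs of the logarithms
  -- are irrelevant here.
  have hCge : (InformationTheory.klDiv Q P₀).toReal + Real.log (regretFactor n)
      + Real.log (1 / δ) ≤ (complexity n δ Q P₀).toReal := by
    rw [complexity, ENNReal.toReal_add (ENNReal.add_ne_top.2 ⟨hkl, ENNReal.ofReal_ne_top⟩)
      ENNReal.ofReal_ne_top, ENNReal.toReal_add hkl ENNReal.ofReal_ne_top, ENNReal.toReal_ofReal',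
      ENNReal.toReal_ofReal']
    exact add_le_add (add_le_add_right (le_max_left _ _) _) (le_max_left _ _)
  have hint : ∀ {u : Θ → ℝ}, Measurable u → (∀ θ, u θ ∈ Set.Icc (0 : ℝ) 1) → Integrable u Q :=
    fun hu hu01 => Integrable.of_bound hu.aestronglyMeasurable 1
      (Filter.Eventually.of_forall fun θ => by
        rw [Real.norm_eq_abs, abs_of_nonneg (hu01 θ).1]; exact (hu01 θ).2)
  have hi1 := hint (measurable_empMean hf x) (empMean_mem_Icc hf01 x)
  have hi2 := hint hm hm01
  have hi12 : Integrable (fun θ => empMean f x θ - m θ) Q := hi1.sub hi2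
  have hi3 := hint ((measurable_sum_sq hf x).const_mul (1 / (n : ℝ))) (mean_sq_mem_Icc hf01 x)
  have hval : ∫ θ, h θ ∂Q =
      n * (g * (∫ θ, empMean f x θ ∂Q - ∫ θ, m θ ∂Q) - r * sampleVar f x Q) := by
    simp only [hh, bernsteinExponent_eq, ← hr]
    rw [integral_const_mul, integral_sub (hi12.const_mul g) (hi3.const_mul r),
      integral_const_mul, integral_const_mul, integral_sub hi1 hi2, integral_const_mul, sampleVar]
  linarith

end Main

end PACBayes

theorem proposition3
    {Ω 𝒳 Θ : Type*} [MeasurableSpace Ω] [MeasurableSpace 𝒳] [MeasurableSpace Θ]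
    (Pr : Measure Ω) [IsProbabilityMeasure Pr]
    (X : ℕ → Ω → 𝒳) (hX_meas : ∀ i, Measurable (X i))
    (hX_indep : iIndepFun X Pr) (hX_ident : ∀ i, IdentDistrib (X i) (X 0) Pr Pr)
    (f : Θ → 𝒳 → ℝ) (hf_meas : Measurable (Function.uncurry f))
    (hf_range : ∀ θ x, f θ x ∈ Set.Icc (0 : ℝ) 1)
    (δ : ℝ) (hδ : δ ∈ Set.Ioc (0 : ℝ) 1)
    (P₀ : Measure Θ) [IsProbabilityMeasure P₀] :
    ∃ E : Set Ω, MeasurableSet E ∧ ENNReal.ofReal (1 - δ) ≤ Pr E ∧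
      ∀ ω ∈ E, ∀ n : ℕ, 1 ≤ n → ∀ (P : Kernel (Fin n → 𝒳) Θ) [IsMarkovKernel P],
        let S : Fin n → 𝒳 := fun i => X i ω
        ENNReal.ofReal
            |(∫ θ, PACBayes.mean Pr (X 0) f θ ∂(P S)) - ∫ θ, PACBayes.empMean f S θ ∂(P S)|
          ≤ PACBayes.bernsteinWidth n (PACBayes.complexity n δ (P S) P₀)
              (ENNReal.ofReal (PACBayes.sampleVar f S (P S))) := by
  have : IsProbabilityMeasure (betaMeasure (1 / 2) (1 / 2)) :=
    isProbabilityMeasureBeta (by norm_num) (by norm_num)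
  obtain ⟨hδ0, hδ1⟩ := hδ
  set m := PACBayes.mean Pr (X 0) f
  have hm : Measurable m := PACBayes.measurable_mean Pr (hX_meas 0) hf_meas
  set ν := P₀.prod (betaMeasure (1 / 2) (1 / 2)) with hν
  have hF := PACBayes.measurable_wealthFactor hf_meas hm
  have hmean : ∀ᵐ z ∂ν, ∀ i, ∫⁻ ω, PACBayes.wealthFactor f m z (X i ω) ∂Pr ≤ 1 := by
    have h : ∀ᵐ z ∂ν, z.2 ∈ Set.Ioo (0 : ℝ) 1 :=
      Measure.quasiMeasurePreserving_snd.ae PACBayes.ae_betaMeasure_mem_Ioo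
    refine h.mono fun z hz i => ?_
    have heq := ((hX_ident i).comp (hF.comp (measurable_prodMk_left (x := z)))).lintegral_eq
    exact heq.trans_le
      (PACBayes.lintegral_wealthFactor_le_one Pr (hX_meas 0) hf_meas hf_range hz)
  have hville := PACBayes.mul_measure_exists_lt_mixtureWealth_le hX_meas hX_indep ν hF hmean
    (ENNReal.ofReal (1 / δ))
  -- The bad event depends on the prior alone, hence the bound holds for all n and all kernels
  -- simultaneously.
  set A : Set Ω := {ω | ∃ n, ENNReal.ofReal (1 / δ) <
    PACBayes.mixtureWealth ν (PACBayes.wealthFactor f m) (fun i : Fin n => X i ω)} with hA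
  have hAm : MeasurableSet A := by
    have : A = ⋃ n, {ω | ENNReal.ofReal (1 / δ) <
        PACBayes.mixtureWealth ν (PACBayes.wealthFactor f m) (fun i : Fin n => X i ω)} := by
      ext; simp [hA]
    rw [this]
    exact MeasurableSet.iUnion fun n => measurableSet_lt measurable_const
      ((PACBayes.measurable_mixtureWealth ν hF n).comp (measurable_pi_lambda _ fun i => hX_meas i))
  have hPrA : Pr A ≤ ENNReal.ofReal δ := by
    have h := mul_le_mul' (le_refl (ENNReal.ofReal δ)) hville
    rwa [← mul_assoc, ← ENNReal.ofReal_mul hδ0.le, mul_one_div_cancel hδ0.ne', ENNReal.ofReal_one,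
      one_mul, mul_one] at h
  refine ⟨Aᶜ, hAm.compl, ?_, ?_⟩
  · rw [prob_compl_eq_one_sub hAm, ENNReal.ofReal_sub _ hδ0.le, ENNReal.ofReal_one]
    exact tsub_le_tsub_left hPrA _
  · intro ω hω n hn P _ S
    have hx : PACBayes.mixtureWealth ν (PACBayes.wealthFactor f m) S ≤ ENNReal.ofReal (1 / δ) :=
      not_lt.1 fun h => hω ⟨n, h⟩
    rw [abs_sub_comm]
    refine PACBayes.ofReal_abs_le_bernsteinWidth hn ?_ fun hC g hg => ?_
    · exact mul_nonneg (by positivity)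
        (integral_nonneg fun θ => Finset.sum_nonneg fun i _ => sq_nonneg _)
    · exact PACBayes.bet_le_complexity P₀ (P S) hf_meas hf_range hm
        (PACBayes.mean_mem_Icc Pr (hX_meas 0) hf_meas hf_range) hδ0 hn hx hC hg
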